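/- Let $\mathbf k$ be an algebraically closed field and $R=\mathbf k[x_0,x_1,y_0,y_1]$ with the bigrading $\deg x_i=(1,0)$, $\deg y_i=(0,1)$. For a point $P=[a_0:a_1]\times[b_0:b_1]$ of $\mathbb P^1\times\mathbb P^1$ let $\wp_P=(a_1x_0-a_0x_1,\ b_1y_0-b_0y_1)\subseteq R$. Let $Z$ be a fat point scheme of $\mathbb P^1\times\mathbb P^1$, that is, a finite set $X=\operatorname{Supp}(Z)$ of points $P$ with positive integer multiplicities $m_P$; its ideal is $I_Z=\bigcap_{P\in X}\wp_P^{m_P}$ and its Hilbert function is $H_Z(i,j)=\dim_{\mathbf k}(R/I_Z)_{i,j}$. Let $\pi_1,\pi_2$ be the two projections of $\mathbb P^1\times\mathbb P^1$ and $(n)_+=\max\{n,0\}$. For $A\in\pi_1(X)$ put $l_A=\max\{m_P : P\in X,\ \pi_1(P)=A\}$, and let $\alpha_Z$ be the tuple of all the numbers $$\sum_{P\in X,\ \pi_1(P)=A}(m_P-h)_+\qquad (A\in\pi_1(X),\ 0\le h\le l_A-1),$$ taken with repetitions and arranged in non-increasing order. Let $\beta_Z$ be the tuple defined in the same way with $\pi_2$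 in place of $\pi_1$. Let $m=|\alpha_Z|$ and $m'=|\beta_Z|$ be the lengths of these tuples. The border of $H_Z$ is the pair $B_Z=(B_C,B_R)$ of the eventual column vector and the eventual row vector $$B_C=(H_Z(m-1,0),\ldots,H_Z(m-1,m'-1)),\qquad B_R=(H_Z(0,m'-1),\ldots,H_Z(m-1,m'-1)).$$ For a tuple $p=(p_1,\ldots,p_n)$ let $\Delta p=(p_1,p_2-p_1,\ldots,p_n-p_{n-1})$. For a partition $\lambda=(\lambda_1\ge\lambda_2\ge\cdots)$ let $\lambda^*=(\lambda_1^*,\ldots,\lambda_{\lambda_1}^*)$ with $\lambda_h^*=\#\{j : \lambda_j\ge h\}$ be its conjugate. Then: (i) $\alpha_Z^*$ has length at most $m'$, and $\Delta B_C=\alpha_Z^*$, where $\alpha_Z^*$ is extended by zeros to length $m'$; (ii) $\beta_Z^*$ has length at most $m$, and $\Delta B_R=\beta_Z^*$, where $\beta_Z^*$ is extended by zeros to length $m$. In particular, the border of $H_Z$ is determined by $\alpha_Z$ and $\beta_Z$: if $Z$ and $W$ are fat point schemes of $\mathbb P^1\times\mathbb P^1$ with $\alpha_W=\alpha_Z$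 and $\beta_W=\beta_Z$, then $B_W=B_Z$. -/

import Mathlib

open scoped LinearAlgebra.Projectivization

noncomputable section

namespace FatPoints

/-- The projective line over `k`. -/
abbrev P1 (k : Type*) [Field k] : Type _ := ℙ k (Fin 2 → k)

/-- The ring `R = k[x₀, x₁, y₀, y₁]`; the left summand indexes the `x`'s, the right one the `y`'s. -/
abbrev BiRing (k : Type*) [Field k] : Type _ := MvPolynomial (Fin 2 ⊕ Fin 2) k

/-- The bidegrees of the variables: `deg xᵢ = (1, 0)` and `deg yᵢ = (0, 1)`. -/
def bidegree : Fin 2 ⊕ Fin 2 → ℕ × ℕ := Sum.elim (fun _ => (1, 0)) (fun _ => (0, 1))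

/-- The space `R_{i,j}` of bihomogeneous elements of degree `(i, j)`. -/
def biPiece (k : Type*) [Field k] (i j : ℕ) : Submodule k (BiRing k) :=
  MvPolynomial.weightedHomogeneousSubmodule k bidegree (i, j)

/-- The form `L_A = a₁x₀ - a₀x₁` of degree `(1, 0)`, for `A = [a₀ : a₁]`. -/
def formX {k : Type*} [Field k] (A : P1 k) : BiRing k :=
  MvPolynomial.C (A.rep 1) * MvPolynomial.X (Sum.inl 0)
    - MvPolynomial.C (A.rep 0) * MvPolynomial.X (Sum.inl 1)

/-- The form `L_B = b₁y₀ - b₀y₁` of degree `(0, 1)`, for `B = [b₀ : b₁]`. -/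
def formY {k : Type*} [Field k] (B : P1 k) : BiRing k :=
  MvPolynomial.C (B.rep 1) * MvPolynomial.X (Sum.inr 0)
    - MvPolynomial.C (B.rep 0) * MvPolynomial.X (Sum.inr 1)

/-- The bihomogeneous prime ideal `(L_A, L_B)` of the point `A × B`. -/
def pointIdeal {k : Type*} [Field k] (P : P1 k × P1 k) : Ideal (BiRing k) :=
  Ideal.span {formX P.1, formY P.2}

/-- A fat point scheme of `ℙ¹ × ℙ¹`, given by its multiplicity function: `Z P` is the multiplicity
of the point `P`, which is positive at the finitely many points of the support and `0` elsewhere. -/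
abbrev FatPointScheme (k : Type*) [Field k] : Type _ := (P1 k × P1 k) →₀ ℕ

/-- The defining ideal `I_Z`, the intersection of the `Z P`-th powers of the ideals of the
points `P` of the support. -/
def fatIdeal {k : Type*} [Field k] (Z : FatPointScheme k) : Ideal (BiRing k) :=
  ⨅ P ∈ Z.support, pointIdeal P ^ Z P

/-- The Hilbert function of `R / I`: the dimension of `R_{i,j} / (I ∩ R_{i,j})`. -/
def hilbertFunction {k : Type*} [Field k] (I : Ideal (BiRing k)) (i j : ℕ) : ℕ :=
  Module.finrank k (biPiece k i j ⧸ (I.restrictScalars k).comap (biPiece k i j).subtype)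

/-- The Hilbert function `H_Z`. -/
def hilb {k : Type*} [Field k] (Z : FatPointScheme k) (i j : ℕ) : ℕ :=
  hilbertFunction (fatIdeal Z) i j

open Classical in
/-- The points of the support of `Z` that lie over `A` under the projection `π`. -/
def fibre {k : Type*} [Field k] (Z : FatPointScheme k) (π : P1 k × P1 k → P1 k) (A : P1 k) :
    Finset (P1 k × P1 k) :=
  Z.support.filter (fun P => π P = A)

/-- The largest multiplicity of a point of `Z` over `A`. -/
def maxMult {k : Type*} [Field k] (Z : FatPointScheme k) (π : P1 k × P1 k → P1 k) (A : P1 k) : ℕ :=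
  (fibre Z π A).sup Z

/-- The number `∑ (m_P - h)₊` over the points `P` of `Z` over `A` (subtraction in `ℕ` is already
the positive part). -/
def fibreSum {k : Type*} [Field k] (Z : FatPointScheme k) (π : P1 k × P1 k → P1 k) (A : P1 k)
    (h : ℕ) : ℕ :=
  ∑ P ∈ fibre Z π A, (Z P - h)

open Classical in
/-- All the numbers `fibreSum Z π A h`, for `A` in the projection of the support and
`0 ≤ h < maxMult Z π A`, with repetitions, arranged in non-increasing order. -/
def multTuple {k : Type*} [Field k] (Z : FatPointScheme k) (π : P1 k × P1 k → P1 k) : List ℕ :=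
  Multiset.sort
    (∑ A ∈ Z.support.image π, (Multiset.range (maxMult Z π A)).map (fibreSum Z π A)) (· ≥ ·)

/-- The tuple `α_Z`, from the first projection. -/
def alphaTuple {k : Type*} [Field k] (Z : FatPointScheme k) : List ℕ := multTuple Z Prod.fst

/-- The tuple `β_Z`, from the second projection. -/
def betaTuple {k : Type*} [Field k] (Z : FatPointScheme k) : List ℕ := multTuple Z Prod.snd

/-- The eventual column vector `B_C = (H_Z(m-1, 0), …, H_Z(m-1, m'-1))`, where `m = |α_Z|` and
`m' = |β_Z|`. -/
def eventualColumn {k : Type*} [Field k] (Z : FatPointScheme k) : List ℕ :=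
  (List.range (betaTuple Z).length).map (fun j => hilb Z ((alphaTuple Z).length - 1) j)

/-- The eventual row vector `B_R = (H_Z(0, m'-1), …, H_Z(m-1, m'-1))`, where `m = |α_Z|` and
`m' = |β_Z|`. -/
def eventualRow {k : Type*} [Field k] (Z : FatPointScheme k) : List ℕ :=
  (List.range (alphaTuple Z).length).map (fun i => hilb Z i ((betaTuple Z).length - 1))

/-- The border `B_Z = (B_C, B_R)` of the Hilbert function of `Z`. -/
def border {k : Type*} [Field k] (Z : FatPointScheme k) : List ℕ × List ℕ :=
  (eventualColumn Z, eventualRow Z)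

end FatPoints

end

namespace FatPoints

/-- The conjugate of a partition `p = (p₁ ≥ p₂ ≥ …)`: the tuple of length `p₁` whose `h`-th entry,
for `1 ≤ h ≤ p₁`, is the number of entries of `p` that are at least `h`. -/
def conjugate (p : List ℕ) : List ℕ :=
  (List.range (p.headD 0)).map (fun h => p.countP (fun a => decide (h + 1 ≤ a)))

/-- The first differences `(p₁, p₂ - p₁, …, p_n - p_{n-1})` of a tuple, as integers. -/
def firstDiff (p : List ℕ) : List ℤ :=
  List.zipWith (fun a b : ℕ => (a : ℤ) - (b : ℤ)) p (0 :: p)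

/-- The tuple `p` of natural numbers, as integers, followed by zeros up to length `n`
(`p` itself if it has at least `n` entries). -/
def padZeros (p : List ℕ) (n : ℕ) : List ℤ :=
  p.map (fun a => (a : ℤ)) ++ List.replicate (n - p.length) 0

end FatPoints

noncomputable section

namespace FatPoints

open MvPolynomial

variable {k : Type*} [Field k]

/-! ### Linear forms of points of the projective line -/

/-! Fix a point `A` of the first factor and set `x = A`. On forms of bidegree `(i, j)` in `I_Z`,
with `i ≥ 1`, this gives an exact sequence `0 → (I_{Z'})_{i-1,j} → (I_Z)_{i,j} → k[y₀, y₁]_j`. The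
first map is multiplication by `L_A`, and `Z' = peel Z A` lowers the multiplicities over `A` by one
(`finrank_ker_evPiece_succ`). Every form in the image is divisible by `∏ L_B ^ m_{A×B}`, of degree
`s = ∑ m_P` over the fibre. All such multiples of degree `j` occur once `i` is at least the sum of
`l_{A'}` over `A' ≠ A`, because the other lines can then be covered by powers of the `L_{A'}`
without vanishing at `A` (`finrank_range_evPiece`).

Hence `dim (I_Z)_{i,j} = (j + 1 - s)₊ + dim (I_{Z'})_{i-1,j}`. Here `s` is the `h = 0` entry of
`α_Z` over `A`, and passing to `Z'` deletes exactly that entry. As `m = ∑ l_A`, peeling one line at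
a time gives `H_Z(i, j) = ∑_{a ∈ α_Z} min(a, j + 1)` for `i + 1 ≥ m` (`finrank_fatPiece_add_cutSum`,
`hilb_eq_cutSum`). Differencing in `j` counts the entries `a ≥ j + 1`, which is the conjugate
partition. The rows follow by exchanging the two factors.

The kernel computation needs `L_A F ∈ ℘_P^n` to be decidable from `F`. For this, membership in
`℘_P^n` is tested by scaling the forms that vanish at `P` by a new variable `t`
(`mem_pointIdeal_pow_iff`). -/

theorem rep_det_ne_zero {A B : P1 k} (h : A ≠ B) :
    A.rep 1 * B.rep 0 - A.rep 0 * B.rep 1 ≠ 0 := by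
  intro h0
  apply h
  rw [← A.mk_rep, ← B.mk_rep, Projectivization.mk_eq_mk_iff']
  have hB := B.rep_nonzero
  by_cases hb : B.rep 0 = 0
  · have hb1 : B.rep 1 ≠ 0 := by
      intro hb1
      apply hB
      funext i
      fin_cases i <;> simpa
    have ha : A.rep 0 = 0 := by
      rw [hb] at h0
      simpa [hb1] using h0
    refine ⟨A.rep 1 / B.rep 1, ?_⟩
    funext i
    fin_cases i
    · simp [ha, hb]
    · simp [hb1]
  · refine ⟨A.rep 0 / B.rep 0, ?_⟩
    funext i
    fin_cases i
    · simp [hb]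
    · simp only [Pi.smul_apply, smul_eq_mul, Fin.mk_one]
      field_simp
      linear_combination -h0

theorem exists_dual (A : P1 k) : ∃ c : Fin 2 → k, c 0 * A.rep 0 + c 1 * A.rep 1 = 1 := by
  by_cases h : A.rep 0 = 0
  · have h1 : A.rep 1 ≠ 0 := by
      intro h1
      apply A.rep_nonzero
      funext i
      fin_cases i <;> simpa
    exact ⟨![0, (A.rep 1)⁻¹], by simp [h1]⟩
  · exact ⟨![(A.rep 0)⁻¹, 0], by simp [h]⟩

/-- The coefficients of a linear form taking the value `1` at the representative of `A`. -/
def dualVec (A : P1 k) : Fin 2 → k := (exists_dual A).choose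

theorem dualVec_spec (A : P1 k) :
    dualVec A 0 * A.rep 0 + dualVec A 1 * A.rep 1 = 1 := (exists_dual A).choose_spec

/-- A vector completing the representative of `A` to a basis dual to `coformX A`, `formX A`. -/
def compVec (A : P1 k) : Fin 2 → k := ![dualVec A 1, -dualVec A 0]

/-- A form of degree `(1, 0)` that does not vanish at `A`. -/
def coformX (A : P1 k) : BiRing k :=
  C (dualVec A 0) * X (Sum.inl 0) + C (dualVec A 1) * X (Sum.inl 1)

/-- A form of degree `(0, 1)` that does not vanish at `B`. -/
def coformY (B : P1 k) : BiRing k :=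
  C (dualVec B 0) * X (Sum.inr 0) + C (dualVec B 1) * X (Sum.inr 1)

theorem C_dualVec_spec (A : P1 k) :
    (C (dualVec A 0) * C (A.rep 0) + C (dualVec A 1) * C (A.rep 1) : BiRing k) = 1 := by
  rw [← C_mul, ← C_mul, ← C_add, dualVec_spec, C_1]

theorem X_inl_eq (A : P1 k) (i : Fin 2) :
    (X (Sum.inl i) : BiRing k) = C (A.rep i) * coformX A + C (compVec A i) * formX A := by
  have := C_dualVec_spec A
  fin_cases i
  · simp only [coformX, formX, compVec, Fin.zero_eta, Matrix.cons_val_zero]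
    linear_combination -X (Sum.inl 0) * this
  · simp only [coformX, formX, compVec, Fin.mk_one, Matrix.cons_val_one, Matrix.cons_val_fin_one,
      C_neg]
    linear_combination -X (Sum.inl 1) * this

theorem X_inr_eq (B : P1 k) (i : Fin 2) :
    (X (Sum.inr i) : BiRing k) = C (B.rep i) * coformY B + C (compVec B i) * formY B := by
  have := C_dualVec_spec B
  fin_cases i
  · simp only [coformY, formY, compVec, Fin.zero_eta, Matrix.cons_val_zero]
    linear_combination -X (Sum.inr 0) * this
  · simp only [coformY, formY, compVec, Fin.mk_one, Matrix.cons_val_one, Matrix.cons_val_fin_one,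
      C_neg]
    linear_combination -X (Sum.inr 1) * this

/-- Evaluation of the variables `x` at the representative of `A`. -/
def evX (A : P1 k) : BiRing k →ₐ[k] BiRing k :=
  aeval (Sum.elim (fun i => C (A.rep i)) (fun i => X (Sum.inr i)))

@[simp] theorem evX_inl (A : P1 k) (i : Fin 2) : evX A (X (Sum.inl i)) = C (A.rep i) := by
  simp [evX]

@[simp] theorem evX_inr (A : P1 k) (i : Fin 2) : evX A (X (Sum.inr i)) = X (Sum.inr i) := by
  simp [evX]

@[simp] theorem evX_C (A : P1 k) (c : k) : evX A (C c) = C c := by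
  rw [← MvPolynomial.algebraMap_eq, AlgHom.commutes]

theorem evX_formX (A B : P1 k) :
    evX A (formX B) = C (B.rep 1 * A.rep 0 - B.rep 0 * A.rep 1) := by
  simp [formX]

theorem evX_formX_self (A : P1 k) : evX A (formX A) = 0 := by
  rw [evX_formX, mul_comm, sub_self, C_0]

theorem evX_formY (A B : P1 k) : evX A (formY B) = formY B := by
  simp [formY]

theorem evX_coformX (A : P1 k) : evX A (coformX A) = 1 := by
  simp only [coformX, map_add, map_mul, evX_C, evX_inl, C_dualVec_spec]

theorem coformX_ne_zero (A : P1 k) : coformX A ≠ 0 := by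
  intro h
  have := evX_coformX A
  rw [h, map_zero] at this
  exact zero_ne_one this

theorem formX_ne_zero (A : P1 k) : formX A ≠ 0 := by
  intro h
  apply A.rep_nonzero
  have h0 : ∀ i, (C (A.rep i) : BiRing k) = 0 → A.rep i = 0 := fun i hi => by simpa using hi
  funext i
  have e0 := congrArg (coeff (Finsupp.single (Sum.inl 0) 1)) h
  have e1 := congrArg (coeff (Finsupp.single (Sum.inl 1) 1)) h
  simp [formX, coeff_X, Finsupp.single_left_inj] at e0 e1
  fin_cases i <;> simp [*]

theorem formY_ne_zero (B : P1 k) : formY B ≠ 0 := by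
  intro h
  apply B.rep_nonzero
  funext i
  have e0 := congrArg (coeff (Finsupp.single (Sum.inr 0) 1)) h
  have e1 := congrArg (coeff (Finsupp.single (Sum.inr 1) 1)) h
  simp [formY, coeff_X, Finsupp.single_left_inj] at e0 e1
  fin_cases i <;> simp [*]

/-! ### Powers of the ideal of a point -/

/-- The homomorphism to the Rees algebra of the ideal of `P` that multiplies the linear forms
vanishing at `P` by the new variable and fixes complementary linear forms. -/
def reesHom (P : P1 k × P1 k) : BiRing k →ₐ[k] Polynomial (BiRing k) :=
  aeval (Sum.elim
    (fun i => Polynomial.C (C (P.1.rep i) * coformX P.1) +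
      Polynomial.X * Polynomial.C (C (compVec P.1 i) * formX P.1))
    (fun i => Polynomial.C (C (P.2.rep i) * coformY P.2) +
      Polynomial.X * Polynomial.C (C (compVec P.2 i) * formY P.2)))

theorem reesHom_C (P : P1 k × P1 k) (c : k) : reesHom P (C c) = Polynomial.C (C c) := by
  rw [← MvPolynomial.algebraMap_eq, AlgHom.commutes]
  rfl

theorem reesHom_inl (P : P1 k × P1 k) (i : Fin 2) : reesHom P (X (Sum.inl i)) =
    Polynomial.C (C (P.1.rep i) * coformX P.1) +
      Polynomial.X * Polynomial.C (C (compVec P.1 i) * formX P.1) := by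
  simp [reesHom]

theorem reesHom_inr (P : P1 k × P1 k) (i : Fin 2) : reesHom P (X (Sum.inr i)) =
    Polynomial.C (C (P.2.rep i) * coformY P.2) +
      Polynomial.X * Polynomial.C (C (compVec P.2 i) * formY P.2) := by
  simp [reesHom]

theorem eval_one_reesHom (P : P1 k × P1 k) (F : BiRing k) : (reesHom P F).eval 1 = F := by
  induction F using MvPolynomial.induction_on with
  | C c => simp
  | add p q hp hq => simp [hp, hq]
  | mul_X p i hp =>
    rcases i with i | i
    · rw [map_mul, reesHom_inl, Polynomial.eval_mul, hp]
      conv_rhs => rw [X_inl_eq P.1 i]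
      simp
    · rw [map_mul, reesHom_inr, Polynomial.eval_mul, hp]
      conv_rhs => rw [X_inr_eq P.2 i]
      simp

theorem formX_mem (P : P1 k × P1 k) : formX P.1 ∈ pointIdeal P :=
  Ideal.subset_span (by simp)

theorem formY_mem (P : P1 k × P1 k) : formY P.2 ∈ pointIdeal P :=
  Ideal.subset_span (by simp)

theorem C_add_X_mul_C_mem_reesAlgebra {R : Type*} [CommRing R] (I : Ideal R) (a b : R)
    (hb : b ∈ I) : Polynomial.C a + Polynomial.X * Polynomial.C b ∈ reesAlgebra I := by
  refine Subalgebra.add_mem _ ((reesAlgebra I).algebraMap_mem a) ?_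
  rw [mul_comm, ← pow_one Polynomial.X, Polynomial.C_mul_X_pow_eq_monomial]
  exact reesAlgebra.monomial_mem.mpr (by simpa using hb)

/-- Gives what is needed of the substitution: the coefficient of `t^i` in `reesHom P F` lies in
`℘_P^i`. -/
theorem reesHom_mem (P : P1 k × P1 k) (F : BiRing k) :
    reesHom P F ∈ reesAlgebra (pointIdeal P) := by
  induction F using MvPolynomial.induction_on with
  | C c =>
    rw [reesHom_C]
    exact (reesAlgebra _).algebraMap_mem _
  | add p q hp hq =>
    rw [map_add]
    exact Subalgebra.add_mem _ hp hq
  | mul_X p i hp =>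
    rw [map_mul]
    refine Subalgebra.mul_mem _ hp ?_
    rcases i with i | i
    · rw [reesHom_inl]
      exact C_add_X_mul_C_mem_reesAlgebra _ _ _ (Ideal.mul_mem_left _ _ (formX_mem P))
    · rw [reesHom_inr]
      exact C_add_X_mul_C_mem_reesAlgebra _ _ _ (Ideal.mul_mem_left _ _ (formY_mem P))

theorem reesHom_formX (P : P1 k × P1 k) (A : P1 k) :
    reesHom P (formX A) =
      Polynomial.C (C (A.rep 1 * P.1.rep 0 - A.rep 0 * P.1.rep 1) * coformX P.1) +
      Polynomial.X * Polynomial.C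
        (C (A.rep 1 * compVec P.1 0 - A.rep 0 * compVec P.1 1) * formX P.1) := by
  conv_lhs => rw [formX]
  simp only [map_sub, map_mul, reesHom_C, reesHom_inl]
  ring

theorem reesHom_formY (P : P1 k × P1 k) (A : P1 k) :
    reesHom P (formY A) =
      Polynomial.C (C (A.rep 1 * P.2.rep 0 - A.rep 0 * P.2.rep 1) * coformY P.2) +
      Polynomial.X * Polynomial.C
        (C (A.rep 1 * compVec P.2 0 - A.rep 0 * compVec P.2 1) * formY P.2) := by
  conv_lhs => rw [formY]
  simp only [map_sub, map_mul, reesHom_C, reesHom_inr]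
  ring

theorem rep_compVec (A : P1 k) : A.rep 1 * compVec A 0 - A.rep 0 * compVec A 1 = 1 := by
  simp only [compVec, Matrix.cons_val_zero, Matrix.cons_val_one, Matrix.cons_val_fin_one]
  linear_combination dualVec_spec A

theorem reesHom_formX_self (P : P1 k × P1 k) :
    reesHom P (formX P.1) = Polynomial.X * Polynomial.C (formX P.1) := by
  rw [reesHom_formX, rep_compVec, mul_comm (P.1.rep 1), sub_self]
  simp

theorem reesHom_formY_self (P : P1 k × P1 k) :
    reesHom P (formY P.2) = Polynomial.X * Polynomial.C (formY P.2) := by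
  rw [reesHom_formY, rep_compVec, mul_comm (P.2.rep 1), sub_self]
  simp

/-- Turns membership in `℘_P^n` into divisibility by a power of the prime `t`, so that linear
factors can be cancelled in a domain. -/
theorem mem_pointIdeal_pow_iff (P : P1 k × P1 k) (n : ℕ) (F : BiRing k) :
    F ∈ pointIdeal P ^ n ↔ Polynomial.X ^ n ∣ reesHom P F := by
  constructor
  · intro hF
    have h1 : (pointIdeal P).map (reesHom P) ≤ Ideal.span {Polynomial.X} := by
      rw [pointIdeal, Ideal.map_span, Ideal.span_le]
      rintro _ ⟨G, hG, rfl⟩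
      rw [SetLike.mem_coe, Ideal.mem_span_singleton]
      rcases hG with rfl | hG
      · rw [reesHom_formX_self]
        exact dvd_mul_right _ _
      · rw [Set.mem_singleton_iff] at hG
        subst hG
        rw [reesHom_formY_self]
        exact dvd_mul_right _ _
    have h2 := Ideal.mem_map_of_mem (reesHom P) hF
    rw [Ideal.map_pow] at h2
    have h3 := Ideal.pow_right_mono h1 n h2
    rwa [Ideal.span_singleton_pow, Ideal.mem_span_singleton] at h3
  · intro hF
    -- At `t = 1` the coefficients of `reesHom P F` sum to `F`. Those below `n` vanish and the
    -- others lie in `℘_P^i ⊆ ℘_P^n`.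
    rw [← eval_one_reesHom P F, Polynomial.eval_eq_sum, Polynomial.sum]
    refine Ideal.sum_mem _ fun i _ => ?_
    rw [one_pow, mul_one]
    by_cases hi : i < n
    · rw [Polynomial.X_pow_dvd_iff.mp hF i hi]
      exact Ideal.zero_mem _
    · exact Ideal.pow_le_pow_right (not_lt.mp hi)
        ((mem_reesAlgebra_iff _ _).mp (reesHom_mem P F) i)

theorem formX_mul_mem_pow_iff_of_eq (P : P1 k × P1 k) (n : ℕ) (F : BiRing k) :
    formX P.1 * F ∈ pointIdeal P ^ n ↔ F ∈ pointIdeal P ^ (n - 1) := by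
  rcases n with _ | n
  · simp
  rw [mem_pointIdeal_pow_iff, mem_pointIdeal_pow_iff, map_mul, reesHom_formX_self, pow_succ',
    mul_assoc, mul_dvd_mul_iff_left Polynomial.X_ne_zero, Nat.add_sub_cancel]
  -- One `t` has been cancelled. The remaining factor `formX P.1` is a nonzero constant in `t`,
  -- hence not divisible by `t`.
  refine ⟨fun h => Polynomial.prime_X.pow_dvd_of_dvd_mul_left _ ?_ h, fun h => h.mul_left _⟩
  rw [Polynomial.X_dvd_iff, Polynomial.coeff_C_zero]
  exact formX_ne_zero _

/-- The constant term in `t` of `reesHom P (formX A)` is `coformX P.1` times the determinant of the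
two representatives, so it is nonzero and `t` does not divide the factor. -/
theorem formX_mul_mem_pow_iff_of_ne (P : P1 k × P1 k) {A : P1 k} (hA : A ≠ P.1) (n : ℕ)
    (F : BiRing k) : formX A * F ∈ pointIdeal P ^ n ↔ F ∈ pointIdeal P ^ n := by
  rw [mem_pointIdeal_pow_iff, mem_pointIdeal_pow_iff, map_mul]
  refine ⟨fun h => Polynomial.prime_X.pow_dvd_of_dvd_mul_left _ ?_ h, fun h => h.mul_left _⟩
  rw [Polynomial.X_dvd_iff, reesHom_formX]
  simp only [Polynomial.coeff_add, Polynomial.coeff_C_zero, Polynomial.mul_coeff_zero,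
    Polynomial.coeff_X_zero, zero_mul, add_zero]
  exact mul_ne_zero ((map_ne_zero_iff _ (C_injective _ _)).mpr (rep_det_ne_zero hA))
    (coformX_ne_zero _)

/-! ### Coprimality of linear forms -/

/-- By Cramer's rule `y₀` and `y₁` are combinations of the two forms, so a common divisor of the
forms divides both variables. -/
theorem isRelPrime_formY {B B' : P1 k} (h : B ≠ B') : IsRelPrime (formY B) (formY B') := by
  have hd := rep_det_ne_zero h
  have hX : IsRelPrime (X (Sum.inr 0) : BiRing k) (X (Sum.inr 1)) := by
    rw [X_prime.irreducible.isRelPrime_iff_not_dvd, X_dvd_X]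
    simp
  intro d h1 h2
  have hu : (C (B.rep 1 * B'.rep 0 - B.rep 0 * B'.rep 1)⁻¹ : BiRing k) *
      (C (B.rep 1) * C (B'.rep 0) - C (B.rep 0) * C (B'.rep 1)) = 1 := by
    rw [← C_mul, ← C_mul, ← C_sub, ← C_mul, inv_mul_cancel₀ hd, C_1]
  set e : BiRing k := C (B.rep 1 * B'.rep 0 - B.rep 0 * B'.rep 1)⁻¹
  refine hX ?_ ?_
  · have : (X (Sum.inr 0) : BiRing k) =
        e * C (B'.rep 0) * formY B - e * C (B.rep 0) * formY B' := by
      simp only [formY]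
      linear_combination -X (Sum.inr 0) * hu
    rw [this]
    exact dvd_sub (h1.mul_left _) (h2.mul_left _)
  · have : (X (Sum.inr 1) : BiRing k) =
        e * C (B'.rep 1) * formY B - e * C (B.rep 1) * formY B' := by
      simp only [formY]
      linear_combination -X (Sum.inr 1) * hu
    rw [this]
    exact dvd_sub (h1.mul_left _) (h2.mul_left _)

/-! ### Bihomogeneous pieces -/

theorem weight_bidegree (d : Fin 2 ⊕ Fin 2 →₀ ℕ) : Finsupp.weight bidegree d =
    (d (Sum.inl 0) + d (Sum.inl 1), d (Sum.inr 0) + d (Sum.inr 1)) := by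
  rw [Finsupp.weight_apply, Finsupp.sum_fintype _ _ (by simp)]
  ext <;> simp [Fin.sum_univ_two, bidegree, -nsmul_eq_mul]

theorem monomial_eq_mul (d : Fin 2 ⊕ Fin 2 →₀ ℕ) (c : k) : (monomial d c : BiRing k) =
    C c * (X (Sum.inl 0) ^ d (Sum.inl 0) * X (Sum.inl 1) ^ d (Sum.inl 1)) *
      (X (Sum.inr 0) ^ d (Sum.inr 0) * X (Sum.inr 1) ^ d (Sum.inr 1)) := by
  rw [monomial_eq, Finsupp.prod_fintype _ _ (by simp)]
  simp [Fin.prod_univ_two, mul_assoc]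

theorem mono_mem_biPiece {i j : ℕ} (c : k) (a b r s : ℕ) (hi : a + b = i) (hj : r + s = j) :
    C c * (X (Sum.inl 0) ^ a * X (Sum.inl 1) ^ b) * (X (Sum.inr 0) ^ r * X (Sum.inr 1) ^ s) ∈
      biPiece k i j := by
  have := isWeightedHomogeneous_monomial bidegree (Finsupp.equivFunOnFinite.symm
    (Sum.elim ![a, b] ![r, s])) c (weight_bidegree _)
  rw [monomial_eq_mul] at this
  simp only [Finsupp.equivFunOnFinite_symm_apply_apply, Sum.elim_inl, Sum.elim_inr,
    Matrix.cons_val_zero, Matrix.cons_val_one, Matrix.cons_val_fin_one, hi, hj] at this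
  exact this

@[elab_as_elim]
theorem biPiece_induction {i j : ℕ} {p : (F : BiRing k) → F ∈ biPiece k i j → Prop}
    (zero : p 0 (Submodule.zero_mem _))
    (add : ∀ F G hF hG, p F hF → p G hG → p (F + G) (Submodule.add_mem _ hF hG))
    (mono : ∀ (c : k) (a b r s : ℕ) (hi : a + b = i) (hj : r + s = j),
      p (C c * (X (Sum.inl 0) ^ a * X (Sum.inl 1) ^ b) *
        (X (Sum.inr 0) ^ r * X (Sum.inr 1) ^ s)) (mono_mem_biPiece c a b r s hi hj))
    {F : BiRing k} (hF : F ∈ biPiece k i j) : p F hF := by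
  change IsWeightedHomogeneous bidegree F (i, j) at hF
  induction hF using IsWeightedHomogeneous.induction_on with
  | zero => exact zero
  | add F G hF hG hF' hG' => exact add F G hF hG hF' hG'
  | monomial d c hd =>
    rw [weight_bidegree, Prod.mk.injEq] at hd
    simp only [monomial_eq_mul]
    exact mono _ _ _ _ _ hd.1 hd.2

theorem mul_mem_biPiece {i j i' j' : ℕ} {F G : BiRing k} (hF : F ∈ biPiece k i j)
    (hG : G ∈ biPiece k i' j') : F * G ∈ biPiece k (i + i') (j + j') :=
  IsWeightedHomogeneous.mul hF hG

theorem C_mem_biPiece (c : k) : (C c : BiRing k) ∈ biPiece k 0 0 :=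
  isWeightedHomogeneous_C _ _

theorem X_inl_mem_biPiece (i : Fin 2) : (X (Sum.inl i) : BiRing k) ∈ biPiece k 1 0 :=
  isWeightedHomogeneous_X _ _ _

theorem X_inr_mem_biPiece (i : Fin 2) : (X (Sum.inr i) : BiRing k) ∈ biPiece k 0 1 :=
  isWeightedHomogeneous_X _ _ _

theorem C_mul_mem_biPiece {i j : ℕ} {F : BiRing k} (c : k) (hF : F ∈ biPiece k i j) :
    C c * F ∈ biPiece k i j := by
  simpa using mul_mem_biPiece (C_mem_biPiece c) hF

theorem pow_mem_biPiece {i j : ℕ} {F : BiRing k} (hF : F ∈ biPiece k i j) (n : ℕ) :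
    F ^ n ∈ biPiece k (n * i) (n * j) := by
  exact IsWeightedHomogeneous.pow hF n

theorem prod_mem_biPiece {ι : Type*} (s : Finset ι) (F : ι → BiRing k) (d e : ι → ℕ)
    (h : ∀ x ∈ s, F x ∈ biPiece k (d x) (e x)) :
    ∏ x ∈ s, F x ∈ biPiece k (∑ x ∈ s, d x) (∑ x ∈ s, e x) := by
  have := IsWeightedHomogeneous.prod s F (fun x => (d x, e x)) h
  have e : ∑ x ∈ s, (d x, e x) = (∑ x ∈ s, d x, ∑ x ∈ s, e x) :=
    Prod.ext Prod.fst_sum Prod.snd_sum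
  rwa [e] at this

theorem formX_mem_biPiece (A : P1 k) : formX A ∈ biPiece k 1 0 :=
  Submodule.sub_mem _ (C_mul_mem_biPiece _ (X_inl_mem_biPiece 0))
    (C_mul_mem_biPiece _ (X_inl_mem_biPiece 1))

theorem coformX_mem_biPiece (A : P1 k) : coformX A ∈ biPiece k 1 0 :=
  Submodule.add_mem _ (C_mul_mem_biPiece _ (X_inl_mem_biPiece 0))
    (C_mul_mem_biPiece _ (X_inl_mem_biPiece 1))

theorem formY_mem_biPiece (B : P1 k) : formY B ∈ biPiece k 0 1 :=
  Submodule.sub_mem _ (C_mul_mem_biPiece _ (X_inr_mem_biPiece 0))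
    (C_mul_mem_biPiece _ (X_inr_mem_biPiece 1))

/-- The exponents of bidegree `(i, j)` are determined by those of `x₀` and `y₀`. -/
def bidegreeEquiv (i j : ℕ) :
    {d : Fin 2 ⊕ Fin 2 →₀ ℕ | Finsupp.weight bidegree d = (i, j)} ≃
      Fin (i + 1) × Fin (j + 1) where
  toFun d := (⟨d.1 (Sum.inl 0), by
      have := d.2
      rw [Set.mem_ofPred_eq, weight_bidegree, Prod.mk.injEq] at this
      omega⟩, ⟨d.1 (Sum.inr 0), by
      have := d.2
      rw [Set.mem_ofPred_eq, weight_bidegree, Prod.mk.injEq] at this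
      omega⟩)
  invFun p := ⟨Finsupp.equivFunOnFinite.symm
      (Sum.elim ![(p.1 : ℕ), i - p.1] ![(p.2 : ℕ), j - p.2]), by
    rw [Set.mem_ofPred_eq, weight_bidegree, Prod.mk.injEq]
    simp
    omega⟩
  left_inv d := by
    have := d.2
    rw [Set.mem_ofPred_eq, weight_bidegree, Prod.mk.injEq] at this
    ext x
    rcases x with x | x <;> fin_cases x <;> simp <;> omega
  right_inv p := by
    ext <;> simp

/-- The monomial basis of `R_{i,j}`. -/
def biPieceBasis (k : Type*) [Field k] (i j : ℕ) :
    Module.Basis (Fin (i + 1) × Fin (j + 1)) k (biPiece k i j) :=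
  ((basisRestrictSupport k {d | Finsupp.weight bidegree d = (i, j)}).map
    (LinearEquiv.ofEq _ _ (weightedHomogeneousSubmodule_eq_finsupp_supported k bidegree
      (i, j)).symm)).reindex (bidegreeEquiv i j)

instance (i j : ℕ) : Module.Finite k (biPiece k i j) :=
  Module.Finite.of_basis (biPieceBasis k i j)

theorem finrank_biPiece (i j : ℕ) : Module.finrank k (biPiece k i j) = (i + 1) * (j + 1) := by
  rw [Module.finrank_eq_card_basis (biPieceBasis k i j)]
  simp

/-- The graded component of `F * G` in the given degree is `F` times a component of `G`. Since `F *
G` is its own component, `F` cancels. -/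
theorem mem_biPiece_of_mul_mem {i j i' j' : ℕ} {F G : BiRing k} (hF : F ∈ biPiece k i j)
    (hF0 : F ≠ 0) (h : F * G ∈ biPiece k (i + i') (j + j')) : G ∈ biPiece k i' j' := by
  let _ := weightedGradedAlgebra k bidegree
  have h1 := DirectSum.coe_decompose_mul_add_of_left_mem
    (weightedHomogeneousSubmodule k bidegree) (i := (i, j)) (j := (i', j')) (b := G) hF
  rw [DirectSum.decompose_of_mem_same (weightedHomogeneousSubmodule k bidegree)
    (i := (i, j) + (i', j')) h] at h1
  rw [mul_left_cancel₀ hF0 h1]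
  exact SetLike.coe_mem _

theorem mul_eq_zero_of_mem_biPiece {i j i' j' : ℕ} {F G : BiRing k} (hF : F ∈ biPiece k i j)
    (h : F * G ∈ biPiece k i' j') (hlt : ¬ (i ≤ i' ∧ j ≤ j')) : F * G = 0 := by
  let _ := weightedGradedAlgebra k bidegree
  have h1 := DirectSum.coe_decompose_mul_of_left_mem_of_not_le
    (weightedHomogeneousSubmodule k bidegree) (i := (i, j)) (n := (i', j')) (b := G) hF
    (by rwa [Prod.mk_le_mk])
  rwa [DirectSum.decompose_of_mem_same (weightedHomogeneousSubmodule k bidegree)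
    (i := (i', j')) h] at h1

/-! ### Evaluation at a point of the first factor -/

theorem evX_mem_biPiece (A : P1 k) {i j : ℕ} {F : BiRing k} (hF : F ∈ biPiece k i j) :
    evX A F ∈ biPiece k 0 j := by
  induction hF using biPiece_induction with
  | zero => rw [map_zero]; exact Submodule.zero_mem _
  | add F G _ _ hF hG => rw [map_add]; exact Submodule.add_mem _ hF hG
  | mono c a b r s hi hj =>
    have h := mul_mem_biPiece (pow_mem_biPiece (X_inr_mem_biPiece (k := k) 0) r)
      (pow_mem_biPiece (X_inr_mem_biPiece 1) s)
    simp only [mul_zero, mul_one, add_zero, hj] at h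
    have h' := C_mul_mem_biPiece (c * (A.rep 0 ^ a * A.rep 1 ^ b)) h
    simpa using h'

theorem evX_eq_self (A : P1 k) {j : ℕ} {F : BiRing k} (hF : F ∈ biPiece k 0 j) :
    evX A F = F := by
  induction hF using biPiece_induction with
  | zero => rw [map_zero]
  | add F G _ _ hF hG => rw [map_add, hF, hG]
  | mono c a b r s hi hj =>
    obtain ⟨rfl, rfl⟩ : a = 0 ∧ b = 0 := by omega
    simp

/-- Modulo `L_A` each `xᵢ` becomes `aᵢ` times `coformX A`, and a form has total degree `i` in the
`x`'s. -/
theorem formX_dvd_sub (A : P1 k) {i j : ℕ} {F : BiRing k} (hF : F ∈ biPiece k i j) :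
    formX A ∣ F - coformX A ^ i * evX A F := by
  induction hF using biPiece_induction with
  | zero => simp
  | add F G _ _ hF hG =>
    rw [map_add, mul_add, add_sub_add_comm]
    exact dvd_add hF hG
  | mono c a b r s hi hj =>
    rw [← Ideal.mem_span_singleton, ← Ideal.Quotient.eq]
    set q := Ideal.Quotient.mk (Ideal.span {formX A})
    have h0 : q (formX A) = 0 :=
      Ideal.Quotient.eq_zero_iff_mem.mpr (Ideal.mem_span_singleton_self _)
    have hx : ∀ i, q (X (Sum.inl i)) = q (C (A.rep i)) * q (coformX A) := by
      intro i
      conv_lhs => rw [X_inl_eq A i]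
      rw [map_add, map_mul, map_mul, h0, mul_zero, add_zero]
    simp only [map_mul, map_pow, evX_C, evX_inl, evX_inr, hx, ← hi]
    ring

theorem exists_eq_formX_mul (A : P1 k) {i j : ℕ} {F : BiRing k} (hF : F ∈ biPiece k (i + 1) j)
    (h : evX A F = 0) : ∃ G ∈ biPiece k i j, F = formX A * G := by
  have h1 := formX_dvd_sub A hF
  rw [h, mul_zero, sub_zero] at h1
  obtain ⟨G, rfl⟩ := h1
  refine ⟨G, mem_biPiece_of_mul_mem (formX_mem_biPiece A) (formX_ne_zero A) ?_, rfl⟩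
  rwa [add_comm 1, zero_add]

theorem finrank_map_of_injective {V W : Type*} [AddCommGroup V] [Module k V] [AddCommGroup W]
    [Module k W] {f : V →ₗ[k] W} (hf : Function.Injective f) (p : Submodule k V) :
    Module.finrank k (p.map f) = Module.finrank k p :=
  (Submodule.equivMapOfInjective f hf p).finrank_eq.symm

theorem mulLeft_injective_of_ne_zero {F : BiRing k} (hF : F ≠ 0) :
    Function.Injective (LinearMap.mulLeft k F) := mul_right_injective₀ hF

/-! ### Bihomogeneous pieces of the ideal of a fat point scheme -/

theorem mem_fatIdeal {Z : FatPointScheme k} {F : BiRing k} :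
    F ∈ fatIdeal Z ↔ ∀ P, F ∈ pointIdeal P ^ Z P := by
  simp only [fatIdeal, Submodule.mem_iInf]
  refine forall_congr' fun P => ⟨fun h => ?_, fun h _ => h⟩
  by_cases hP : P ∈ Z.support
  · exact h hP
  · rw [Finsupp.notMem_support_iff.mp hP, pow_zero, Ideal.one_eq_top]
    trivial

open Classical in
/-- The residual scheme of `Z` with respect to the line over `A`: the multiplicities of the points
over `A` are lowered by one. -/
def peel (Z : FatPointScheme k) (A : P1 k) : FatPointScheme k :=
  Finsupp.onFinset Z.support (fun P => if P.1 = A then Z P - 1 else Z P) (by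
    intro P hP
    rw [Finsupp.mem_support_iff]
    intro h
    simp [h] at hP)

theorem peel_apply_of_eq (Z : FatPointScheme k) (P : P1 k × P1 k) :
    peel Z P.1 P = Z P - 1 := by
  simp [peel]

theorem peel_apply_of_ne (Z : FatPointScheme k) {A : P1 k} {P : P1 k × P1 k} (h : P.1 ≠ A) :
    peel Z A P = Z P := by
  simp [peel, h]

/-- Identifies the colon ideal `I_Z : L_A`, one point of the support at a time. -/
theorem formX_mul_mem_fatIdeal_iff {Z : FatPointScheme k} {A : P1 k} {F : BiRing k} :
    formX A * F ∈ fatIdeal Z ↔ F ∈ fatIdeal (peel Z A) := by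
  rw [mem_fatIdeal, mem_fatIdeal]
  refine forall_congr' fun P => ?_
  by_cases hP : P.1 = A
  · subst hP
    rw [peel_apply_of_eq, formX_mul_mem_pow_iff_of_eq]
  · rw [peel_apply_of_ne Z hP, formX_mul_mem_pow_iff_of_ne P (Ne.symm hP)]

/-- The forms of degree `(i, j)` in `I_Z`. -/
def fatPiece (Z : FatPointScheme k) (i j : ℕ) : Submodule k (BiRing k) :=
  biPiece k i j ⊓ (fatIdeal Z).restrictScalars k

theorem mem_fatPiece {Z : FatPointScheme k} {i j : ℕ} {F : BiRing k} :
    F ∈ fatPiece Z i j ↔ F ∈ biPiece k i j ∧ F ∈ fatIdeal Z := Iff.rfl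

instance (Z : FatPointScheme k) (i j : ℕ) : Module.Finite k (fatPiece Z i j) :=
  Submodule.finiteDimensional_of_le (inf_le_left : _ ≤ biPiece k i j)

theorem hilb_add_finrank (Z : FatPointScheme k) (i j : ℕ) :
    hilb Z i j + Module.finrank k (fatPiece Z i j) = (i + 1) * (j + 1) := by
  have h := Submodule.finrank_quotient_add_finrank
    (((fatIdeal Z).restrictScalars k).comap (biPiece k i j).subtype)
  rw [finrank_biPiece] at h
  rw [← h, hilb, hilbertFunction, Nat.add_left_cancel_iff, fatPiece,
    ← Submodule.map_comap_subtype]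
  exact finrank_map_of_injective (Submodule.injective_subtype _) _

/-- The form of degree `(0, s)` whose zeros are the points of `Z` over `A`, with multiplicities. -/
def fibreForm (Z : FatPointScheme k) (A : P1 k) : BiRing k :=
  ∏ P ∈ fibre Z Prod.fst A, formY P.2 ^ Z P

theorem fibreForm_mem_biPiece (Z : FatPointScheme k) (A : P1 k) :
    fibreForm Z A ∈ biPiece k 0 (fibreSum Z Prod.fst A 0) := by
  have := prod_mem_biPiece (fibre Z Prod.fst A) (fun P => formY P.2 ^ Z P) _ _
    (fun P _ => pow_mem_biPiece (formY_mem_biPiece P.2) (Z P))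
  simpa [fibreSum, fibreForm] using this

theorem fibreForm_ne_zero (Z : FatPointScheme k) (A : P1 k) : fibreForm Z A ≠ 0 :=
  Finset.prod_ne_zero_iff.mpr fun P _ => pow_ne_zero _ (formY_ne_zero P.2)

theorem mem_fibre {Z : FatPointScheme k} {π : P1 k × P1 k → P1 k} {A : P1 k}
    {P : P1 k × P1 k} : P ∈ fibre Z π A ↔ Z P ≠ 0 ∧ π P = A := by
  simp [fibre]

theorem evX_pow_dvd {P : P1 k × P1 k} {n : ℕ} {F : BiRing k} (hF : F ∈ pointIdeal P ^ n) :
    formY P.2 ^ n ∣ evX P.1 F := by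
  have h1 : (pointIdeal P).map (evX P.1) ≤ Ideal.span {formY P.2} := by
    rw [pointIdeal, Ideal.map_span, Ideal.span_le]
    rintro _ ⟨G, hG, rfl⟩
    rw [SetLike.mem_coe, Ideal.mem_span_singleton]
    rcases hG with rfl | hG
    · rw [evX_formX_self]
      exact dvd_zero _
    · rw [Set.mem_singleton_iff] at hG
      rw [hG, evX_formY]
  have h2 := Ideal.mem_map_of_mem (evX P.1) hF
  rw [Ideal.map_pow] at h2
  have h3 := Ideal.pow_right_mono h1 n h2
  rwa [Ideal.span_singleton_pow, Ideal.mem_span_singleton] at h3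

/-- Setting `x = A` sends `℘_{A×B}` into `(L_B)`. Distinct points of one fibre have distinct second
coordinates, so the powers of the `L_B` are pairwise coprime and their product divides. -/
theorem fibreForm_dvd_evX {Z : FatPointScheme k} (A : P1 k) {F : BiRing k}
    (hF : F ∈ fatIdeal Z) : fibreForm Z A ∣ evX A F := by
  refine Finset.prod_dvd_of_isRelPrime ?_ ?_
  · intro P hP Q hQ hne
    rw [Finset.mem_coe, mem_fibre] at hP hQ
    have : P.2 ≠ Q.2 := fun h => hne (Prod.ext (hP.2.trans hQ.2.symm) h)
    exact (isRelPrime_formY this).pow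
  · intro P hP
    rw [mem_fibre] at hP
    rw [← hP.2]
    exact evX_pow_dvd (mem_fatIdeal.mp hF P)

theorem le_maxMult {Z : FatPointScheme k} {π : P1 k × P1 k → P1 k} (P : P1 k × P1 k) :
    Z P ≤ maxMult Z π (π P) := by
  by_cases hP : Z P = 0
  · simp [hP]
  · exact Finset.le_sup (f := Z) (mem_fibre.mpr ⟨hP, rfl⟩)

open Classical in
/-- The product of powers of the lines over the points other than `A` containing the part of `Z`
that does not lie over `A`. -/
def residualForm (Z : FatPointScheme k) (A : P1 k) : BiRing k :=
  ∏ A' ∈ (Z.support.image Prod.fst).erase A, formX A' ^ maxMult Z Prod.fst A'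

open Classical in
theorem residualForm_mem_biPiece (Z : FatPointScheme k) (A : P1 k) : residualForm Z A ∈
    biPiece k (∑ A' ∈ (Z.support.image Prod.fst).erase A, maxMult Z Prod.fst A') 0 := by
  have := prod_mem_biPiece ((Z.support.image Prod.fst).erase A)
    (fun A' => formX A' ^ maxMult Z Prod.fst A') _ _
    (fun A' _ => pow_mem_biPiece (formX_mem_biPiece A') (maxMult Z Prod.fst A'))
  simpa [residualForm] using this

theorem exists_evX_residualForm (Z : FatPointScheme k) (A : P1 k) :
    ∃ c : k, c ≠ 0 ∧ evX A (residualForm Z A) = C c := by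
  classical
  refine ⟨∏ A' ∈ (Z.support.image Prod.fst).erase A,
    (A'.rep 1 * A.rep 0 - A'.rep 0 * A.rep 1) ^ maxMult Z Prod.fst A', ?_, ?_⟩
  · refine Finset.prod_ne_zero_iff.mpr fun A' hA' => pow_ne_zero _ (rep_det_ne_zero ?_)
    exact Finset.ne_of_mem_erase hA'
  · rw [residualForm, map_prod, map_prod]
    exact Finset.prod_congr rfl fun A' _ => by rw [map_pow, evX_formX, C_pow]

theorem residualForm_mul_fibreForm_mem (Z : FatPointScheme k) (A : P1 k) :
    residualForm Z A * fibreForm Z A ∈ fatIdeal Z := by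
  classical
  rw [mem_fatIdeal]
  intro P
  by_cases h0 : Z P = 0
  · simp [h0]
  by_cases hP : P.1 = A
  · refine Ideal.mul_mem_left _ _ (Ideal.mem_of_dvd _ (Finset.dvd_prod_of_mem _
      (mem_fibre.mpr ⟨h0, hP⟩)) (Ideal.pow_mem_pow (formY_mem P) _))
  · refine Ideal.mul_mem_right _ _ (Ideal.mem_of_dvd _ (Finset.dvd_prod_of_mem _
      (a := P.1) ?_) (Ideal.pow_le_pow_right (le_maxMult P) (Ideal.pow_mem_pow (formX_mem P) _)))
    rw [Finset.mem_erase, Finset.mem_image]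
    exact ⟨hP, P, by simpa using h0, rfl⟩

/-- The evaluation at `A` of the forms of degree `(i, j)` in `I_Z`. -/
def evPiece (Z : FatPointScheme k) (A : P1 k) (i j : ℕ) : fatPiece Z i j →ₗ[k] BiRing k :=
  (evX A).toLinearMap ∘ₗ (fatPiece Z i j).subtype

theorem evPiece_apply (Z : FatPointScheme k) (A : P1 k) (i j : ℕ) (F : fatPiece Z i j) :
    evPiece Z A i j F = evX A F := rfl

open Classical in
theorem exists_evX_eq_fibreForm_mul {Z : FatPointScheme k} {A : P1 k} {i j : ℕ}
    (hi : ∑ A' ∈ (Z.support.image Prod.fst).erase A, maxMult Z Prod.fst A' ≤ i) {Q : BiRing k}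
    (hQ : Q ∈ biPiece k 0 j) : ∃ F ∈ fatPiece Z i (fibreSum Z Prod.fst A 0 + j),
      evX A F = fibreForm Z A * Q := by
  obtain ⟨c, hc, he⟩ := exists_evX_residualForm Z A
  obtain ⟨n, rfl⟩ := Nat.exists_eq_add_of_le hi
  -- The power of `coformX A`, which is `1` at `A`, fills up the missing degree `n` in `x`; `c⁻¹`
  -- cancels the value of `residualForm Z A` at `A`.
  refine ⟨residualForm Z A * fibreForm Z A * (C c⁻¹ * (coformX A ^ n * Q)), ⟨?_, ?_⟩, ?_⟩
  · have h1 := mul_mem_biPiece (residualForm_mem_biPiece Z A) (fibreForm_mem_biPiece Z A)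
    have h2 := C_mul_mem_biPiece c⁻¹
      (mul_mem_biPiece (pow_mem_biPiece (coformX_mem_biPiece A) n) hQ)
    simpa using mul_mem_biPiece h1 h2
  · exact Ideal.mul_mem_right _ _ (residualForm_mul_fibreForm_mem Z A)
  · have hC : (C c * C c⁻¹ : BiRing k) = 1 := by rw [← C_mul, mul_inv_cancel₀ hc, C_1]
    rw [map_mul, map_mul, he, map_mul, map_mul, map_pow, evX_coformX, evX_C, evX_eq_self A hQ,
      evX_eq_self A (fibreForm_mem_biPiece Z A)]
    linear_combination fibreForm Z A * Q * hC

open Classical in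
-- The truncated subtraction covers both cases: for `j` below the degree of `fibreForm Z A`,
-- divisibility forces the image to be zero.
theorem finrank_range_evPiece {Z : FatPointScheme k} {A : P1 k} {i : ℕ} (j : ℕ)
    (hi : ∑ A' ∈ (Z.support.image Prod.fst).erase A, maxMult Z Prod.fst A' ≤ i) :
    Module.finrank k (LinearMap.range (evPiece Z A i j)) = j + 1 - fibreSum Z Prod.fst A 0 := by
  by_cases hs : fibreSum Z Prod.fst A 0 ≤ j
  · obtain ⟨j', rfl⟩ := Nat.exists_eq_add_of_le hs
    have : LinearMap.range (evPiece Z A i (fibreSum Z Prod.fst A 0 + j')) =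
        (biPiece k 0 j').map (LinearMap.mulLeft k (fibreForm Z A)) := by
      ext G
      constructor
      · rintro ⟨F, rfl⟩
        obtain ⟨Q, hQ⟩ := fibreForm_dvd_evX A F.2.2
        refine ⟨Q, mem_biPiece_of_mul_mem (fibreForm_mem_biPiece Z A) (fibreForm_ne_zero Z A) ?_,
          hQ.symm⟩
        rw [← hQ]
        exact evX_mem_biPiece A F.2.1
      · rintro ⟨Q, hQ, rfl⟩
        obtain ⟨F, hF, he⟩ := exists_evX_eq_fibreForm_mul hi hQ
        exact ⟨⟨F, hF⟩, he⟩
    rw [this, finrank_map_of_injective (mulLeft_injective_of_ne_zero (fibreForm_ne_zero Z A)),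
      finrank_biPiece]
    omega
  · have : LinearMap.range (evPiece Z A i j) = ⊥ := by
      rw [eq_bot_iff]
      rintro _ ⟨F, rfl⟩
      obtain ⟨Q, hQ⟩ := fibreForm_dvd_evX A F.2.2
      rw [evPiece_apply, Submodule.mem_bot, hQ]
      refine mul_eq_zero_of_mem_biPiece (i' := 0) (j' := j) (fibreForm_mem_biPiece Z A) ?_
        fun h => hs h.2
      rw [← hQ]
      exact evX_mem_biPiece A F.2.1
    rw [this, finrank_bot]
    omega

theorem ker_evPiece_zero (Z : FatPointScheme k) (A : P1 k) (j : ℕ) :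
    LinearMap.ker (evPiece Z A 0 j) = ⊥ := by
  rw [LinearMap.ker_eq_bot']
  intro F hF
  rw [evPiece_apply, evX_eq_self A F.2.1] at hF
  exact Subtype.ext hF

theorem finrank_ker_evPiece_succ (Z : FatPointScheme k) (A : P1 k) (i j : ℕ) :
    Module.finrank k (LinearMap.ker (evPiece Z A (i + 1) j)) =
      Module.finrank k (fatPiece (peel Z A) i j) := by
  rw [← finrank_map_of_injective (Submodule.injective_subtype (fatPiece Z (i + 1) j)),
    ← finrank_map_of_injective (mulLeft_injective_of_ne_zero (formX_ne_zero A))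
      (fatPiece (peel Z A) i j)]
  -- Both spaces are compared inside the polynomial ring, where the kernel is `L_A` times the piece
  -- of the residual scheme.
  suffices h : (LinearMap.ker (evPiece Z A (i + 1) j)).map (fatPiece Z (i + 1) j).subtype =
      (fatPiece (peel Z A) i j).map (LinearMap.mulLeft k (formX A)) by rw [h]
  ext F
  constructor
  · rintro ⟨F, hF, rfl⟩
    obtain ⟨G, hG, he⟩ := exists_eq_formX_mul A F.2.1 hF
    refine ⟨G, ⟨hG, formX_mul_mem_fatIdeal_iff.mp ?_⟩, he.symm⟩
    rw [← he]
    exact F.2.2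
  · rintro ⟨G, hG, rfl⟩
    refine ⟨⟨formX A * G, ?_, formX_mul_mem_fatIdeal_iff.mpr hG.2⟩, ?_, rfl⟩
    · have := mul_mem_biPiece (formX_mem_biPiece A) hG.1
      rwa [add_comm 1, zero_add] at this
    · change evX A (formX A * G) = 0
      rw [map_mul, evX_formX_self, zero_mul]

open Classical in
theorem finrank_fatPiece_zero {Z : FatPointScheme k} {A : P1 k} (j : ℕ)
    (h : ∑ A' ∈ (Z.support.image Prod.fst).erase A, maxMult Z Prod.fst A' ≤ 0) :
    Module.finrank k (fatPiece Z 0 j) = j + 1 - fibreSum Z Prod.fst A 0 := by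
  rw [← LinearMap.finrank_range_add_finrank_ker (evPiece Z A 0 j), finrank_range_evPiece j h,
    ker_evPiece_zero, finrank_bot, add_zero]

open Classical in
theorem finrank_fatPiece_succ {Z : FatPointScheme k} {A : P1 k} {i : ℕ} (j : ℕ)
    (h : ∑ A' ∈ (Z.support.image Prod.fst).erase A, maxMult Z Prod.fst A' ≤ i + 1) :
    Module.finrank k (fatPiece Z (i + 1) j) =
      (j + 1 - fibreSum Z Prod.fst A 0) + Module.finrank k (fatPiece (peel Z A) i j) := by
  rw [← LinearMap.finrank_range_add_finrank_ker (evPiece Z A (i + 1) j),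
    finrank_range_evPiece j h, finrank_ker_evPiece_succ]

/-! ### Multiplicities along the fibres -/

theorem maxMult_le_iff {Z : FatPointScheme k} {π : P1 k × P1 k → P1 k} {A : P1 k} {n : ℕ} :
    maxMult Z π A ≤ n ↔ ∀ P, π P = A → Z P ≤ n := by
  rw [maxMult, Finset.sup_le_iff]
  refine forall_congr' fun P => ?_
  rw [mem_fibre]
  refine ⟨fun h hP => ?_, fun h hP => h hP.2⟩
  by_cases h0 : Z P = 0
  · simp [h0]
  · exact h ⟨h0, hP⟩

theorem maxMult_peel_self (Z : FatPointScheme k) (A : P1 k) :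
    maxMult (peel Z A) Prod.fst A = maxMult Z Prod.fst A - 1 := by
  refine eq_of_forall_ge_iff fun n => ?_
  rw [tsub_le_iff_right, maxMult_le_iff, maxMult_le_iff]
  refine forall₂_congr fun P hP => ?_
  subst hP
  rw [peel_apply_of_eq, tsub_le_iff_right]

theorem maxMult_peel_of_ne (Z : FatPointScheme k) {A A' : P1 k} (h : A' ≠ A) :
    maxMult (peel Z A) Prod.fst A' = maxMult Z Prod.fst A' := by
  refine eq_of_forall_ge_iff fun n => ?_
  rw [maxMult_le_iff, maxMult_le_iff]
  refine forall₂_congr fun P hP => ?_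
  rw [peel_apply_of_ne Z (hP.trans_ne h)]

theorem peel_apply_le (Z : FatPointScheme k) (A : P1 k) (P : P1 k × P1 k) :
    peel Z A P ≤ Z P := by
  by_cases hP : P.1 = A
  · subst hP
    rw [peel_apply_of_eq]
    exact Nat.sub_le _ _
  · rw [peel_apply_of_ne Z hP]

theorem fibreSum_peel (Z : FatPointScheme k) (A A' : P1 k) (h : ℕ) :
    fibreSum (peel Z A) Prod.fst A' h = ∑ P ∈ fibre Z Prod.fst A', (peel Z A P - h) := by
  refine Finset.sum_subset (fun P hP => ?_) fun P hP hP' => ?_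
  · rw [mem_fibre] at hP ⊢
    have := peel_apply_le Z A P
    exact ⟨by omega, hP.2⟩
  · rw [mem_fibre] at hP hP'
    have : peel Z A P = 0 := by
      by_contra h0
      exact hP' ⟨h0, hP.2⟩
    rw [this, Nat.zero_sub]

/-- Since `(m - 1) - h = m - (h + 1)`, peeling shifts the entries over `A` and so loses only the one
with `h = 0`. -/
theorem fibreSum_peel_self (Z : FatPointScheme k) (A : P1 k) (h : ℕ) :
    fibreSum (peel Z A) Prod.fst A h = fibreSum Z Prod.fst A (h + 1) := by
  rw [fibreSum_peel]
  refine Finset.sum_congr rfl fun P hP => ?_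
  rw [mem_fibre] at hP
  obtain ⟨-, rfl⟩ := hP
  rw [peel_apply_of_eq]
  omega

theorem fibreSum_peel_of_ne (Z : FatPointScheme k) {A A' : P1 k} (hA : A' ≠ A) (h : ℕ) :
    fibreSum (peel Z A) Prod.fst A' h = fibreSum Z Prod.fst A' h := by
  rw [fibreSum_peel]
  refine Finset.sum_congr rfl fun P hP => ?_
  rw [mem_fibre] at hP
  rw [peel_apply_of_ne Z (hP.2.trans_ne hA)]

/-- The sum of the numbers `min (fibreSum Z π A h) n`, for `A ∈ T` and `h < maxMult Z π A`. -/
def cutSum (Z : FatPointScheme k) (π : P1 k × P1 k → P1 k) (T : Finset (P1 k)) (n : ℕ) : ℕ :=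
  ∑ A ∈ T, ∑ h ∈ Finset.range (maxMult Z π A), min (fibreSum Z π A h) n

theorem cutSum_eq_add_cutSum_peel (Z : FatPointScheme k) {T : Finset (P1 k)} {A : P1 k}
    (hA : A ∈ T) (h0 : maxMult Z Prod.fst A ≠ 0) (n : ℕ) :
    cutSum Z Prod.fst T n =
      min (fibreSum Z Prod.fst A 0) n + cutSum (peel Z A) Prod.fst T n := by
  classical
  obtain ⟨l, hl⟩ := Nat.exists_eq_succ_of_ne_zero h0
  rw [cutSum, cutSum, ← Finset.add_sum_erase T _ hA, ← Finset.add_sum_erase T _ hA, ← add_assoc]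
  congr 1
  · rw [maxMult_peel_self, hl, Nat.succ_sub_one, Finset.sum_range_succ', add_comm]
    simp only [fibreSum_peel_self]
  · refine Finset.sum_congr rfl fun A' hA' => ?_
    have hne := Finset.ne_of_mem_erase hA'
    simp only [maxMult_peel_of_ne Z hne, fibreSum_peel_of_ne Z hne]

theorem fatPiece_eq_biPiece {Z : FatPointScheme k} (h : ∀ P, Z P = 0) (i j : ℕ) :
    fatPiece Z i j = biPiece k i j := by
  refine inf_eq_left.mpr fun F _ => ?_
  change F ∈ fatIdeal Z
  rw [mem_fatIdeal]
  intro P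
  simp [h P]

theorem finrank_fatPiece_of_sum_eq_zero {Z : FatPointScheme k} {T : Finset (P1 k)}
    (hT : ∀ P, Z P ≠ 0 → P.1 ∈ T) (h : ∑ A ∈ T, maxMult Z Prod.fst A = 0) (i j : ℕ) :
    Module.finrank k (fatPiece Z i j) + cutSum Z Prod.fst T (j + 1) = (i + 1) * (j + 1) := by
  rw [Finset.sum_eq_zero_iff] at h
  rw [fatPiece_eq_biPiece, finrank_biPiece, cutSum, Finset.sum_eq_zero, add_zero]
  · intro A hA
    rw [h A hA, Finset.sum_range_zero]
  · intro P
    by_contra h0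
    have := le_maxMult (Z := Z) (π := Prod.fst) P
    rw [h _ (hT P h0)] at this
    omega

/-- Peeling a line with `l_A > 0` lowers both `i` and the total multiplicity by one, so the bound
persists; it also leaves `∑_{A' ≠ A} l_{A'} ≤ i`, as surjectivity requires. `T` is fixed during the
induction because the projection of the support may shrink. -/
theorem finrank_fatPiece_add_cutSum {T : Finset (P1 k)} {i : ℕ} (j : ℕ) {Z : FatPointScheme k}
    (hT : ∀ P, Z P ≠ 0 → P.1 ∈ T) (h : ∑ A ∈ T, maxMult Z Prod.fst A ≤ i + 1) :
    Module.finrank k (fatPiece Z i j) + cutSum Z Prod.fst T (j + 1) = (i + 1) * (j + 1) := by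
  classical
  induction i generalizing Z with
  | zero =>
    by_cases h0 : ∑ A ∈ T, maxMult Z Prod.fst A = 0
    · exact finrank_fatPiece_of_sum_eq_zero hT h0 _ _
    obtain ⟨A, hA, hA0⟩ := Finset.exists_ne_zero_of_sum_ne_zero h0
    have hsplit := Finset.add_sum_erase T (maxMult Z Prod.fst) hA
    have hsub : (Z.support.image Prod.fst).erase A ⊆ T.erase A :=
      Finset.erase_subset_erase A (Finset.image_subset_iff.mpr fun P hP => hT P (by simpa using hP))
    have hle := Finset.sum_le_sum_of_subset (f := maxMult Z Prod.fst) hsub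
    have hpT : ∀ P, peel Z A P ≠ 0 → P.1 ∈ T := fun P hP =>
      hT P (by have := peel_apply_le Z A P; omega)
    have hp : ∑ A' ∈ T, maxMult (peel Z A) Prod.fst A' = 0 := by
      rw [← Finset.add_sum_erase T _ hA, maxMult_peel_self, Finset.sum_congr rfl fun A' hA' =>
        maxMult_peel_of_ne Z (Finset.ne_of_mem_erase hA')]
      omega
    -- The total multiplicity was one, so nothing is left after peeling; comparing dimensions shows
    -- that the remaining `cutSum` is zero.
    have hc := finrank_fatPiece_of_sum_eq_zero hpT hp 0 j
    rw [fatPiece_eq_biPiece, finrank_biPiece] at hc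
    · rw [finrank_fatPiece_zero (A := A) j (by omega), cutSum_eq_add_cutSum_peel Z hA hA0]
      omega
    · intro P
      by_contra hP
      have h1 := le_maxMult (Z := peel Z A) (π := Prod.fst) P
      have h2 := Finset.sum_eq_zero_iff.mp hp _ (hpT P hP)
      omega
  | succ i ih =>
    by_cases h0 : ∑ A ∈ T, maxMult Z Prod.fst A = 0
    · exact finrank_fatPiece_of_sum_eq_zero hT h0 _ _
    obtain ⟨A, hA, hA0⟩ := Finset.exists_ne_zero_of_sum_ne_zero h0
    have hsplit := Finset.add_sum_erase T (maxMult Z Prod.fst) hA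
    have hsub : (Z.support.image Prod.fst).erase A ⊆ T.erase A :=
      Finset.erase_subset_erase A (Finset.image_subset_iff.mpr fun P hP => hT P (by simpa using hP))
    have hle := Finset.sum_le_sum_of_subset (f := maxMult Z Prod.fst) hsub
    have hpT : ∀ P, peel Z A P ≠ 0 → P.1 ∈ T := fun P hP =>
      hT P (by have := peel_apply_le Z A P; omega)
    have hp : ∑ A' ∈ T, maxMult (peel Z A) Prod.fst A' ≤ i + 1 := by
      rw [← Finset.add_sum_erase T _ hA, maxMult_peel_self, Finset.sum_congr rfl fun A' hA' =>
        maxMult_peel_of_ne Z (Finset.ne_of_mem_erase hA')]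
      omega
    have hc := ih hpT hp
    rw [finrank_fatPiece_succ (A := A) j (by omega), cutSum_eq_add_cutSum_peel Z hA hA0]
    have : (i + 1 + 1) * (j + 1) = (i + 1) * (j + 1) + (j + 1) := by ring
    -- Uses `(j + 1 - s) + min s (j + 1) = j + 1`, where `s` is the peeled entry.
    omega

open Classical in
theorem hilb_eq_cutSum {Z : FatPointScheme k} {i : ℕ} (j : ℕ)
    (h : ∑ A ∈ Z.support.image Prod.fst, maxMult Z Prod.fst A ≤ i + 1) :
    hilb Z i j = cutSum Z Prod.fst (Z.support.image Prod.fst) (j + 1) := by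
  have h1 := hilb_add_finrank Z i j
  have h2 := finrank_fatPiece_add_cutSum (T := Z.support.image Prod.fst) j (fun P hP =>
    Finset.mem_image_of_mem _ (Finsupp.mem_support_iff.mpr hP)) h
  omega

/-! ### The tuples of a fat point scheme -/

open Classical in
/-- The multiset of the entries of `multTuple Z π`. -/
def multMultiset (Z : FatPointScheme k) (π : P1 k × P1 k → P1 k) : Multiset ℕ :=
  ∑ A ∈ Z.support.image π, (Multiset.range (maxMult Z π A)).map (fibreSum Z π A)

theorem coe_multTuple (Z : FatPointScheme k) (π : P1 k × P1 k → P1 k) :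
    (multTuple Z π : Multiset ℕ) = multMultiset Z π :=
  Multiset.sort_eq _ _

theorem multTuple_pairwise (Z : FatPointScheme k) (π : P1 k × P1 k → P1 k) :
    (multTuple Z π).Pairwise (· ≥ ·) :=
  Multiset.pairwise_sort _ _

open Classical in
theorem length_multTuple (Z : FatPointScheme k) (π : P1 k × P1 k → P1 k) :
    (multTuple Z π).length = ∑ A ∈ Z.support.image π, maxMult Z π A := by
  rw [← Multiset.coe_card, coe_multTuple, multMultiset, Multiset.card_sum]
  simp

open Classical in
theorem sum_map_min_multTuple (Z : FatPointScheme k) (π : P1 k × P1 k → P1 k) (n : ℕ) :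
    ((multTuple Z π).map (fun a => min a n)).sum = cutSum Z π (Z.support.image π) n := by
  rw [← Multiset.sum_coe, ← Multiset.map_coe, coe_multTuple, multMultiset, cutSum]
  -- Bundled as an additive homomorphism, the map-then-sum distributes over the sum of multisets.
  change ((Multiset.sumAddMonoidHom : Multiset ℕ →+ ℕ).comp
    (Multiset.mapAddMonoidHom (fun a => min a n))) _ = _
  rw [map_sum]
  refine Finset.sum_congr rfl fun A _ => ?_
  change (((Multiset.range (maxMult Z π A)).map (fibreSum Z π A)).map
    (fun a => min a n)).sum = _
  rw [Multiset.map_map]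
  rfl

theorem mem_multTuple {Z : FatPointScheme k} {π : P1 k × P1 k → P1 k} {a : ℕ}
    (ha : a ∈ multTuple Z π) : ∃ A h, fibreSum Z π A h = a := by
  classical
  rw [← Multiset.mem_coe, coe_multTuple, multMultiset, Multiset.mem_sum] at ha
  obtain ⟨A, -, ha⟩ := ha
  obtain ⟨h, -, rfl⟩ := Multiset.mem_map.mp ha
  exact ⟨A, h, rfl⟩

/-- Each `m_P` is at most `l_B` for the second coordinate `B` of `P`. These coordinates are distinct
along a fibre, and the sum of all `l_B` is `m'`. -/
theorem fibreSum_fst_le (Z : FatPointScheme k) (A : P1 k) (h : ℕ) :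
    fibreSum Z Prod.fst A h ≤ (betaTuple Z).length := by
  classical
  rw [betaTuple, length_multTuple]
  calc fibreSum Z Prod.fst A h ≤ ∑ P ∈ fibre Z Prod.fst A, maxMult Z Prod.snd P.2 :=
        Finset.sum_le_sum fun P _ => (Nat.sub_le _ _).trans (le_maxMult P)
    _ = ∑ B ∈ (fibre Z Prod.fst A).image Prod.snd, maxMult Z Prod.snd B := by
        rw [Finset.sum_image]
        intro P hP Q hQ he
        rw [Finset.mem_coe, mem_fibre] at hP hQ
        exact Prod.ext (hP.2.trans hQ.2.symm) he
    _ ≤ _ := Finset.sum_le_sum_of_subset (Finset.image_subset_image (Finset.filter_subset _ _))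

theorem hilb_eq_sum_map_min (Z : FatPointScheme k) (j : ℕ) :
    hilb Z ((alphaTuple Z).length - 1) j = ((alphaTuple Z).map (fun a => min a (j + 1))).sum := by
  rw [alphaTuple, sum_map_min_multTuple]
  refine hilb_eq_cutSum j ?_
  rw [← length_multTuple]
  -- `m ≤ (m - 1) + 1` also holds for the empty scheme, where `m - 1` truncates to `0`.
  omega

theorem eventualColumn_eq (Z : FatPointScheme k) : eventualColumn Z =
    (List.range (betaTuple Z).length).map
      (fun j => ((alphaTuple Z).map (fun a => min a (j + 1))).sum) := by
  simp only [eventualColumn, hilb_eq_sum_map_min]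

/-! ### Differences and conjugates of tuples -/

theorem firstDiff_map_range (c : ℕ → ℕ) (h0 : c 0 = 0) (n : ℕ) :
    firstDiff ((List.range n).map (fun j => c (j + 1))) =
      (List.range n).map (fun j => (c (j + 1) : ℤ) - c j) := by
  refine List.ext_getElem (by simp [firstDiff]) fun i h1 h2 => ?_
  rcases i with _ | i
  · simp [firstDiff, h0]
  · simp [firstDiff]

/-- Raising the cap from `n` to `n + 1` adds one for each entry exceeding `n`. -/
theorem sum_map_min_succ (p : List ℕ) (n : ℕ) :
    (p.map (fun a => min a (n + 1))).sum =
      (p.map (fun a => min a n)).sum + p.countP (fun a => decide (n + 1 ≤ a)) := by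
  induction p with
  | nil => rfl
  | cons a p ih =>
    rw [List.map_cons, List.map_cons, List.sum_cons, List.sum_cons, List.countP_cons, ih]
    by_cases h : n + 1 ≤ a
    · simp [h]
      omega
    · simp [h]
      omega

theorem le_headD_of_pairwise {p : List ℕ} (hp : p.Pairwise (· ≥ ·)) {a : ℕ} (ha : a ∈ p) :
    a ≤ p.headD 0 := by
  rcases p with _ | ⟨b, p⟩
  · simp at ha
  · rcases List.mem_cons.mp ha with rfl | ha
    · exact le_rfl
    · exact (List.pairwise_cons.mp hp).1 a ha

theorem headD_le {p : List ℕ} {n : ℕ} (h : ∀ a ∈ p, a ≤ n) : p.headD 0 ≤ n := by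
  rcases p with _ | ⟨b, p⟩
  · simp
  · exact h b (by simp)

theorem padZeros_eq (p : List ℕ) (n : ℕ) :
    padZeros p n = p.map (fun a : ℕ => (a : ℤ)) ++ List.replicate (n - p.length) 0 := by
  simp [padZeros, List.map_eq_flatMap]

theorem padZeros_conjugate {p : List ℕ} (hp : p.Pairwise (· ≥ ·)) {n : ℕ}
    (h : p.headD 0 ≤ n) : padZeros (conjugate p) n =
      (List.range n).map (fun j => (p.countP (fun a => decide (j + 1 ≤ a)) : ℤ)) := by
  refine List.ext_getElem ?_ fun i h1 h2 => ?_
  · simp only [padZeros_eq, conjugate, List.length_append, List.length_map, List.length_range,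
      List.length_replicate]
    omega
  · by_cases hi : i < p.headD 0
    · simp only [padZeros_eq]
      rw [List.getElem_append_left (by simpa [conjugate] using hi)]
      simp [conjugate]
    · simp only [padZeros_eq]
      -- Past the largest entry of `p` nothing is counted, which matches the padding.
      rw [List.getElem_append_right (by simpa [conjugate] using hi)]
      simp only [List.getElem_replicate, List.getElem_map, List.getElem_range]
      symm
      rw [Nat.cast_eq_zero, List.countP_eq_zero]
      intro a ha
      have := le_headD_of_pairwise hp ha
      simp
      omega

theorem headD_alphaTuple_le (Z : FatPointScheme k) :
    (alphaTuple Z).headD 0 ≤ (betaTuple Z).length := by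
  refine headD_le fun a ha => ?_
  obtain ⟨A, h, rfl⟩ := mem_multTuple ha
  exact fibreSum_fst_le Z A h

theorem length_conjugate_alphaTuple_le (Z : FatPointScheme k) :
    (conjugate (alphaTuple Z)).length ≤ (betaTuple Z).length := by
  simpa [conjugate] using headD_alphaTuple_le Z

theorem firstDiff_eventualColumn (Z : FatPointScheme k) :
    firstDiff (eventualColumn Z) =
      padZeros (conjugate (alphaTuple Z)) (betaTuple Z).length := by
  rw [eventualColumn_eq, padZeros_conjugate (p := alphaTuple Z) (multTuple_pairwise Z Prod.fst)
    (headD_alphaTuple_le Z), firstDiff_map_range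
      (fun n => ((alphaTuple Z).map (fun a => min a n)).sum) (by simp)]
  refine List.map_congr_left fun j _ => ?_
  rw [sum_map_min_succ]
  push_cast
  ring

/-! ### Exchanging the two factors -/

/-- The image of `Z` under the exchange of the two factors. -/
def swap (Z : FatPointScheme k) : FatPointScheme k :=
  Z.equivMapDomain (Equiv.prodComm _ _)

theorem swap_apply (Z : FatPointScheme k) (P : P1 k × P1 k) : swap Z P = Z P.swap := rfl

theorem swap_swap (Z : FatPointScheme k) : swap (swap Z) = Z := by
  ext P
  rfl

/-- The exchange of the variables `x` and `y`. -/
def swapVars (k : Type*) [Field k] : BiRing k →ₐ[k] BiRing k := rename Sum.swap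

theorem swapVars_swapVars (F : BiRing k) : swapVars k (swapVars k F) = F := by
  rw [swapVars, rename_rename, Sum.swap_swap_eq, rename_id_apply]

theorem swapVars_mem_biPiece {i j : ℕ} {F : BiRing k} (hF : F ∈ biPiece k i j) :
    swapVars k F ∈ biPiece k j i := by
  induction hF using biPiece_induction with
  | zero =>
    rw [map_zero]
    exact Submodule.zero_mem _
  | add F G _ _ hF hG =>
    rw [map_add]
    exact Submodule.add_mem _ hF hG
  | mono c a b r s hi hj =>
    have := mono_mem_biPiece c r s a b hj hi
    rw [mul_right_comm] at this
    simpa [swapVars] using this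

theorem swapVars_mem_pow {P : P1 k × P1 k} {n : ℕ} {F : BiRing k}
    (hF : F ∈ pointIdeal P ^ n) : swapVars k F ∈ pointIdeal P.swap ^ n := by
  have h1 : (pointIdeal P).map (swapVars k) ≤ pointIdeal P.swap := by
    rw [pointIdeal, Ideal.map_span, Ideal.span_le]
    rintro _ ⟨G, hG, rfl⟩
    rcases hG with rfl | hG
    · have : swapVars k (formX P.1) = formY P.1 := by simp [swapVars, formX, formY]
      rw [this]
      exact formY_mem P.swap
    · rw [Set.mem_singleton_iff] at hG
      have : swapVars k (formY P.2) = formX P.2 := by simp [swapVars, formX, formY]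
      rw [hG, this]
      exact formX_mem P.swap
  have h2 := Ideal.mem_map_of_mem (swapVars k) hF
  rw [Ideal.map_pow] at h2
  exact Ideal.pow_right_mono h1 n h2

theorem swapVars_mem_fatPiece {Z : FatPointScheme k} {i j : ℕ} {F : BiRing k}
    (hF : F ∈ fatPiece Z i j) : swapVars k F ∈ fatPiece (swap Z) j i := by
  rw [mem_fatPiece, mem_fatIdeal] at hF ⊢
  refine ⟨swapVars_mem_biPiece hF.1, fun P => ?_⟩
  have := swapVars_mem_pow (hF.2 P.swap)
  rwa [Prod.swap_swap] at this

theorem finrank_fatPiece_swap (Z : FatPointScheme k) (i j : ℕ) :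
    Module.finrank k (fatPiece (swap Z) j i) = Module.finrank k (fatPiece Z i j) := by
  have hinj : Function.Injective (swapVars k).toLinearMap :=
    Function.LeftInverse.injective (g := swapVars k) swapVars_swapVars
  rw [← finrank_map_of_injective hinj (fatPiece Z i j)]
  suffices h : fatPiece (swap Z) j i = (fatPiece Z i j).map (swapVars k).toLinearMap by rw [h]
  ext F
  constructor
  · intro hF
    refine ⟨swapVars k F, ?_, swapVars_swapVars F⟩
    have := swapVars_mem_fatPiece hF
    rwa [swap_swap] at this
  · rintro ⟨G, hG, rfl⟩
    exact swapVars_mem_fatPiece hG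

theorem hilb_swap (Z : FatPointScheme k) (i j : ℕ) : hilb (swap Z) j i = hilb Z i j := by
  have h1 := hilb_add_finrank Z i j
  have h2 := hilb_add_finrank (swap Z) j i
  rw [finrank_fatPiece_swap, mul_comm] at h2
  omega

/-- With `π` arbitrary, both exchanges `α ↔ β` are instances: `π ∘ Prod.swap` unfolds to the other
projection. -/
theorem multTuple_swap (Z : FatPointScheme k) (π : P1 k × P1 k → P1 k) :
    multTuple (swap Z) π = multTuple Z (π ∘ Prod.swap) := by
  classical
  have hfib : ∀ A, fibre (swap Z) π A =
      (fibre Z (π ∘ Prod.swap) A).map (Equiv.prodComm _ _).toEmbedding := by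
    intro A
    ext P
    rw [Finset.mem_map_equiv, mem_fibre, mem_fibre, swap_apply]
    rfl
  have himg : (swap Z).support.image π = Z.support.image (π ∘ Prod.swap) := by
    ext A
    simp only [Finset.mem_image, Finsupp.mem_support_iff, swap_apply, Function.comp_apply]
    exact ⟨fun ⟨P, h, e⟩ => ⟨P.swap, h, e⟩, fun ⟨P, h, e⟩ => ⟨P.swap, h, e⟩⟩
  have hmax : ∀ A, maxMult (swap Z) π A = maxMult Z (π ∘ Prod.swap) A := by
    intro A
    rw [maxMult, hfib, Finset.sup_map]
    rfl
  have hsum : ∀ A, fibreSum (swap Z) π A = fibreSum Z (π ∘ Prod.swap) A := by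
    intro A
    funext h
    rw [fibreSum, hfib, Finset.sum_map]
    rfl
  simp only [multTuple, himg, hmax, hsum]

theorem alphaTuple_swap (Z : FatPointScheme k) : alphaTuple (swap Z) = betaTuple Z :=
  multTuple_swap Z Prod.fst

theorem betaTuple_swap (Z : FatPointScheme k) : betaTuple (swap Z) = alphaTuple Z :=
  multTuple_swap Z Prod.snd

theorem eventualColumn_swap (Z : FatPointScheme k) :
    eventualColumn (swap Z) = eventualRow Z := by
  simp only [eventualColumn, eventualRow, alphaTuple_swap, betaTuple_swap, hilb_swap]

/-- By `eventualColumn_eq` the scheme enters the column only through `α` and the length of `β`. -/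
theorem eventualColumn_congr {Z W : FatPointScheme k} (ha : alphaTuple W = alphaTuple Z)
    (hb : betaTuple W = betaTuple Z) : eventualColumn W = eventualColumn Z := by
  rw [eventualColumn_eq, eventualColumn_eq, ha, hb]

end FatPoints

end

theorem corollary3p12 {k : Type*} [Field k] [IsAlgClosed k] (Z : FatPoints.FatPointScheme k) :
    ((FatPoints.conjugate (FatPoints.alphaTuple Z)).length ≤ (FatPoints.betaTuple Z).length ∧
      FatPoints.firstDiff (FatPoints.eventualColumn Z) =
        FatPoints.padZeros (FatPoints.conjugate (FatPoints.alphaTuple Z))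
          (FatPoints.betaTuple Z).length) ∧
    ((FatPoints.conjugate (FatPoints.betaTuple Z)).length ≤ (FatPoints.alphaTuple Z).length ∧
      FatPoints.firstDiff (FatPoints.eventualRow Z) =
        FatPoints.padZeros (FatPoints.conjugate (FatPoints.betaTuple Z))
          (FatPoints.alphaTuple Z).length) ∧
    (∀ W : FatPoints.FatPointScheme k,
      FatPoints.alphaTuple W = FatPoints.alphaTuple Z →
      FatPoints.betaTuple W = FatPoints.betaTuple Z →
      FatPoints.border W = FatPoints.border Z) := by
  open FatPoints in
  refine ⟨⟨length_conjugate_alphaTuple_le Z, firstDiff_eventualColumn Z⟩, ⟨?_, ?_⟩, ?_⟩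
  · rw [← alphaTuple_swap Z, ← betaTuple_swap Z]
    exact length_conjugate_alphaTuple_le (swap Z)
  · rw [← alphaTuple_swap Z, ← betaTuple_swap Z, ← eventualColumn_swap]
    exact firstDiff_eventualColumn (swap Z)
  · intro W ha hb
    refine Prod.ext (eventualColumn_congr ha hb) ?_
    change eventualRow W = eventualRow Z
    -- Rows are columns of the swapped schemes, whose tuples are `β` and `α`.
    rw [← eventualColumn_swap, ← eventualColumn_swap]
    refine eventualColumn_congr ?_ ?_
    · rw [alphaTuple_swap, alphaTuple_swap, hb]
    · rw [betaTuple_swap, betaTuple_swap, ha]
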